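/- Let $S=\{\mathbf x\in\ell^1:\ x_k\ge 0 \text{ for all } k\in\mathbb N,\ \|\mathbf x\|_1=1\}$ be the infinite dimensional simplex, $\mathbb N=\{1,2,\dots\}$. A map $V:S\to S$ is a Volterra operator if there is a real matrix $(a_{ki})_{k,i\in\mathbb N}$ with $a_{ki}=-a_{ik}$ and $|a_{ki}|\le 1$ for all $k,i$ such that $$(V(\mathbf x))_k=x_k\Bigl(1+\sum_{i=1}^\infty a_{ki}x_i\Bigr)\qquad(\mathbf x\in S,\ k\in\mathbb N);$$ the matrix is then uniquely determined by $V$. Let $\tilde{\mathcal V}^+$ (respectively $\tilde{\mathcal V}^-$) be the set of all Volterra operators for which there is a $k_0\ge 1$ such that $a_{ki}=0$ whenever $k<k_0\le i$, and $a_{ki}\ge 0$ (respectively $a_{ki}\le 0$) whenever $k_0\le k<i$. For $\mathbf x_0\in S$ put $$\omega_V(\mathbf x_0)=\bigcap_{n\ge 1}\overline{\{V^k(\mathbf x_0):k\ge n\}}^{\,\|\cdot\|_1},\qquad \omega_V^{(w)}(\mathbf x_0)=\bigcap_{n\ge 1}\overline{\{V^k(\mathbf x_0):k\ge n\}}^{\,\mathrm{p.w.}},$$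 where the first closure is taken in $\ell^1$ for the norm, and the second in the space of all real sequences for the topology of pointwise convergence. Theorem. Let $V\in\tilde{\mathcal V}^+\cup\tilde{\mathcal V}^-$. Then for every $\mathbf x_0\in S$: (i) if $\omega_V(\mathbf x_0)\ne\emptyset$, then $\omega_V(\mathbf x_0)$ either has exactly one element or is infinite; (ii) $\omega_V^{(w)}(\mathbf x_0)$ either has exactly one element or is infinite. -/

import Mathlib

namespace Volterra

/-- The Banach space `ℓ¹` of absolutely summable real sequences (coordinates numbered from `0`). -/
abbrev Ell1 : Type := lp (fun _ : ℕ => ℝ) 1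

/-- The infinite dimensional simplex: the nonnegative elements of `ℓ¹` of norm one. -/
def simplex : Set Ell1 := {x | (∀ k, 0 ≤ x k) ∧ ‖x‖ = 1}

/-- The skew-symmetric infinite real matrices with entries bounded by one in absolute value. -/
def skewMatrices : Set (ℕ → ℕ → ℝ) :=
  {a | ∀ k i, a k i = -a i k ∧ |a k i| ≤ 1}

/-- `V` is the Volterra operator with matrix `a`:
`(V x)_k = x_k (1 + ∑_i a_{ki} x_i)` for every `x` in the simplex and every `k`. For a matrix in
`skewMatrices` the series converges absolutely, and `a` is determined by `V`. -/
def HasMatrix (V : simplex → simplex) (a : ℕ → ℕ → ℝ) : Prop :=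
  a ∈ skewMatrices ∧
    ∀ (x : simplex) (k : ℕ), (V x).1 k = x.1 k * (1 + ∑' i, a k i * x.1 i)

/-- The class `Ṽ⁺`: the matrix of `V` is block diagonal, with a finite (possibly empty) square
block indexed by `k < k₀`, and a block indexed by `k ≥ k₀` that is nonnegative above the
diagonal. -/
def classPlus : Set (simplex → simplex) :=
  {V | ∃ a, HasMatrix V a ∧ ∃ k₀ : ℕ,
    (∀ k i, k < k₀ → k₀ ≤ i → a k i = 0) ∧ (∀ k i, k₀ ≤ k → k < i → 0 ≤ a k i)}

/-- The class `Ṽ⁻`: the same with a second block that is nonpositive above the diagonal. -/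
def classMinus : Set (simplex → simplex) :=
  {V | ∃ a, HasMatrix V a ∧ ∃ k₀ : ℕ,
    (∀ k i, k < k₀ → k₀ ≤ i → a k i = 0) ∧ (∀ k i, k₀ ≤ k → k < i → a k i ≤ 0)}

/-- The omega-limit set of `x₀` with respect to the `ℓ¹` norm. -/
def omegaNorm (V : simplex → simplex) (x₀ : simplex) : Set Ell1 :=
  ⋂ n ≥ 1, closure {y : Ell1 | ∃ k ≥ n, y = (V^[k] x₀).1}

/-- The omega-limit set of `x₀` with respect to pointwise convergence: closures are taken in the
space `ℕ → ℝ` of all sequences with its product topology. -/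
def omegaPointwise (V : simplex → simplex) (x₀ : simplex) : Set (ℕ → ℝ) :=
  ⋂ n ≥ 1, closure {y : ℕ → ℝ | ∃ k ≥ n, y = fun j => (V^[k] x₀).1 j}

end Volterra

open Filter Topology Finset

namespace Volterra

/-! ### Cluster points of sequences that follow a map -/

section ClusterPoints

variable {X : Type*} [TopologicalSpace X]

/-! The two diagonal blocks do not interact. In the second, the sign condition makes mass flow in
one direction, so all partial masses are monotone in time and every coordinate converges. Hence
cluster points differ only in the first, finite block, where the orbit follows the polynomial map
`headMap`, continuous for pointwise convergence. If the cluster points are finite in number,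
compactness of the cube makes the orbit eventually run through them as one cycle of `headMap`
(`subsingleton_of_finite_mapClusterPt`). A Volterra operator in finite dimension has no nontrivial
cycles (`stationary_of_periodic`), so only one point remains. In norm, a single cluster point rules
out loss of mass, and the two limit sets then have the same points (`exists_mapClusterPt_norm`). -/

theorem iInter_closure_tail (u : ℕ → X) :
    ⋂ n ≥ 1, closure {y : X | ∃ k ≥ n, y = u k} = {y | MapClusterPt y atTop u} := by
  ext y
  simp only [Set.mem_iInter, mem_closure_iff_nhds, Set.mem_ofPred_eq, mapClusterPt_iff_frequently,
    frequently_atTop]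
  constructor
  · intro h U hU n
    obtain ⟨_, hz, k, hk, rfl⟩ := h (n + 1) (by omega) U hU
    exact ⟨k, by omega, hz⟩
  · intro h n _ U hU
    obtain ⟨k, hk, hz⟩ := h U hU n
    exact ⟨_, hz, k, hk, rfl⟩

theorem neBot_inf_comap_of_mapClusterPt {u : ℕ → X} {y : X} (hy : MapClusterPt y atTop u) :
    (atTop ⊓ comap u (𝓝 y)).NeBot := by
  rw [neBot_inf_comap_iff_map, inf_comm]
  exact hy

/-- The filter `atTop ⊓ comap u (𝓝 y)` describes the late times at which `u` is near `y`. -/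
theorem mapClusterPt_of_tendsto_succ {u : ℕ → X} {y z : X} (hy : MapClusterPt y atTop u)
    (h : Tendsto (fun n => u (n + 1)) (atTop ⊓ comap u (𝓝 y)) (𝓝 z)) :
    MapClusterPt z atTop u := by
  have := neBot_inf_comap_of_mapClusterPt hy
  exact (h.mapClusterPt.mono inf_le_left).of_comp (φ := fun n => n + 1) (tendsto_add_atTop_nat 1)

/-- If a sequence in a compact set follows a map `T` near each of its finitely many cluster points,
then these form a single cycle of `T`; if periodic points are fixed, there is only one. -/
theorem subsingleton_of_finite_mapClusterPt [T2Space X] {K : Set X} (hK : IsCompact K)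
    {u : ℕ → X} (hu : ∀ n, u n ∈ K) {T : X → X} (hfin : {y | MapClusterPt y atTop u}.Finite)
    (hT : ∀ y, MapClusterPt y atTop u →
      Tendsto (fun n => u (n + 1)) (atTop ⊓ comap u (𝓝 y)) (𝓝 (T y)))
    (hper : ∀ y, MapClusterPt y atTop u → ∀ m, 0 < m → T^[m] y = y → T y = y) :
    {y | MapClusterPt y atTop u}.Subsingleton := by
  set F := {y | MapClusterPt y atTop u} with hF
  obtain ⟨U, hU, hdisj⟩ := hfin.t2_separation
  have hTF : ∀ y ∈ F, T y ∈ F := fun y hy => mapClusterPt_of_tendsto_succ hy (hT y hy)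
  have hfollow : ∀ y ∈ F, ∃ N : Set X, y ∈ N ∧ IsOpen N ∧
      ∀ᶠ n in atTop, u n ∈ N → u (n + 1) ∈ U (T y) := by
    intro y hy
    have h := hT y hy ((hU (T y)).2.mem_nhds (hU (T y)).1)
    rw [Filter.mem_map, mem_inf_iff_superset] at h
    obtain ⟨A, hA, B, hB, hAB⟩ := h
    obtain ⟨C, hC, hCB⟩ := mem_comap.1 hB
    obtain ⟨N, hNC, hN, hyN⟩ := mem_nhds_iff.1 hC
    exact ⟨N, hyN, hN, mem_of_superset hA fun n hn hnN => hAB ⟨hn, hCB (hNC hnN)⟩⟩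
  choose! N hyN hNopen hN using hfollow
  -- Otherwise the compact remainder of `K` would contain a further cluster point.
  have hcover : ∀ᶠ n in atTop, ∃ y ∈ F, u n ∈ U y ∩ N y := by
    by_contra hne
    have hopen : IsOpen (⋃ y ∈ F, U y ∩ N y) :=
      isOpen_biUnion fun y hy => (hU y).2.inter (hNopen y hy)
    obtain ⟨y, hyK, hy⟩ := (hK.diff hopen).exists_mapClusterPt_of_frequently (f := u) (l := atTop)
      ((not_eventually.1 hne).mono fun n hn => ⟨hu n, fun h => hn <| by
        obtain ⟨y, hy, h⟩ := Set.mem_iUnion₂.1 h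
        exact ⟨y, hy, h⟩⟩)
    exact hyK.2 (Set.mem_biUnion (show y ∈ F from hy) ⟨(hU y).1, hyN y hy⟩)
  have hstep := (eventually_all_finite hfin).2 hN
  obtain ⟨n₀, hn₀⟩ := eventually_atTop.1 (hcover.and hstep)
  have : Nonempty X := ⟨u 0⟩
  choose! p hpF hp using fun n hn => (hn₀ n hn).1
  have huniq : ∀ n ≥ n₀, ∀ y ∈ F, u n ∈ U y → p n = y := fun n hn y hy hny =>
    hdisj.elim_set (hpF n hn) hy (u n) (hp n hn).1 hny
  have hpT : ∀ n ≥ n₀, p (n + 1) = T (p n) := fun n hn =>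
    huniq (n + 1) (by omega) _ (hTF _ (hpF n hn)) ((hn₀ n hn).2 _ (hpF n hn) (hp n hn).2)
  have hiter : ∀ n ≥ n₀, ∀ j, p (n + j) = T^[j] (p n) := by
    intro n hn j
    induction j with
    | zero => rfl
    | succ j ih => rw [← add_assoc, hpT _ (by omega), ih, Function.iterate_succ_apply']
  -- Each cluster point recurs as the label `p k`; two visits to it make it periodic under `T`.
  have hvisit : ∀ y ∈ F, ∀ n, ∃ k ≥ n, k ≥ n₀ ∧ p k = y := by
    intro y hy n
    obtain ⟨k, hk, hky⟩ := frequently_atTop.1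
      ((mapClusterPt_iff_frequently.1 hy) (U y) ((hU y).2.mem_nhds (hU y).1)) (max n n₀)
    exact ⟨k, le_of_max_le_left hk, le_of_max_le_right hk, huniq k (le_of_max_le_right hk) y hy hky⟩
  intro y hy z hz
  obtain ⟨k, -, hk, rfl⟩ := hvisit y hy 0
  obtain ⟨l, hl, -, hly⟩ := hvisit _ hy (k + 1)
  have hfix : T (p k) = p k := by
    refine hper _ hy (l - k) (by omega) ?_
    rw [← hiter k hk, Nat.add_sub_cancel' (by omega), hly]
  obtain ⟨j, hj, -, rfl⟩ := hvisit z hz k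
  rw [← Nat.add_sub_cancel' hj, hiter k hk, Function.iterate_fixed hfix]

end ClusterPoints

/-! ### Periodic orbits in finite dimension -/

theorem sum_mul_sum_skew {ι : Type*} (s : Finset ι) {a : ι → ι → ℝ}
    (ha : ∀ k i, a k i = -a i k) (x : ι → ℝ) : ∑ k ∈ s, x k * ∑ i ∈ s, a k i * x i = 0 := by
  have h : ∑ k ∈ s, x k * ∑ i ∈ s, a k i * x i = -∑ k ∈ s, x k * ∑ i ∈ s, a k i * x i := by
    simp only [mul_sum]
    conv_lhs => rw [sum_comm]
    simp only [← sum_neg_distrib]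
    refine sum_congr rfl fun k _ => sum_congr rfl fun i _ => ?_
    rw [ha i k]
    ring
  linarith

/-- A periodic orbit of a finite dimensional Volterra operator is stationary. -/
theorem stationary_of_periodic {ι : Type*} (s : Finset ι) {a : ι → ι → ℝ}
    (ha : ∀ k i, a k i = -a i k) {y : ℕ → ι → ℝ} (hy : ∀ t, ∀ k ∈ s, 0 ≤ y t k)
    (hstep : ∀ t, ∀ k ∈ s, y (t + 1) k = y t k * (1 + ∑ i ∈ s, a k i * y t i))
    {m : ℕ} (hm : 0 < m) (hper : ∀ k ∈ s, y m k = y 0 k) {k : ι} (hk : k ∈ s) :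
    y 1 k = y 0 k := by
  set v : ℕ → ι → ℝ := fun t k => ∑ i ∈ s, a k i * y t i with hv
  have hzero : ∀ k ∈ s, ∀ t, y t k = 0 → ∀ j, y (t + j) k = 0 := by
    intro k hk t ht j
    induction j with
    | zero => exact ht
    | succ j ih => rw [← add_assoc, hstep _ k hk, ih, zero_mul]
  have hpos : ∀ k ∈ s, 0 < y 0 k → ∀ t ≤ m, 0 < y t k := by
    intro k hk h0 t ht
    refine (hy t k hk).lt_of_ne' fun h => h0.ne' ?_
    rw [← hper k hk, ← hzero k hk t h (m - t), Nat.add_sub_cancel' ht]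
  have hlog : ∀ k ∈ s, 0 < y 0 k → ∀ t < m,
      0 < 1 + v t k ∧ Real.log (1 + v t k) = Real.log (y (t + 1) k) - Real.log (y t k) := by
    intro k hk h0 t ht
    have h1 := hpos k hk h0 t ht.le
    have h2 := hpos k hk h0 (t + 1) ht
    have h3 : 0 < 1 + v t k := by
      rw [hstep t k hk] at h2
      exact pos_of_mul_pos_right h2 h1.le
    refine ⟨h3, ?_⟩
    rw [hstep t k hk, Real.log_mul h1.ne' h3.ne']
    ring
  have hsumlog : ∀ k ∈ s, 0 < y 0 k → ∑ t ∈ range m, Real.log (1 + v t k) = 0 := by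
    intro k hk h0
    rw [sum_congr rfl fun t ht => (hlog k hk h0 t (mem_range.1 ht)).2,
      sum_range_sub (fun t => Real.log (y t k)), hper k hk, sub_self]
  have hle : ∀ k ∈ s, 0 < y 0 k → ∀ t ∈ range m, Real.log (1 + v t k) ≤ v t k := by
    intro k hk h0 t ht
    linarith [Real.log_le_sub_one_of_pos (hlog k hk h0 t (mem_range.1 ht)).1]
  set Y : ι → ℝ := fun k => ∑ t ∈ range m, y t k with hY
  have hv_sum : ∀ k, ∑ t ∈ range m, v t k = ∑ i ∈ s, a k i * Y i := by
    intro k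
    simp only [hv, hY, mul_sum]
    exact sum_comm
  have hYzero : ∀ k ∈ s, y 0 k = 0 → Y k = 0 := by
    intro k hk h0
    refine sum_eq_zero fun t _ => ?_
    simpa using hzero k hk 0 h0 t
  have hYpos : ∀ k ∈ s, 0 < y 0 k → 0 < Y k := fun k hk h0 =>
    sum_pos (fun t ht => hpos k hk h0 t (mem_range.1 ht).le) ⟨0, mem_range.2 hm⟩
  -- Over one period, `log (1 + v) ≤ v` gives `0 ≤ ∑ v = (aY)_k` wherever `Y k > 0`. Skew-symmetry
  -- makes the sum of these terms vanish, so each is zero and equality holds in every logarithmic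
  -- inequality, forcing `v = 0`.
  have hterm : ∀ k ∈ s, 0 ≤ Y k * ∑ i ∈ s, a k i * Y i := by
    intro k hk
    rcases (hy 0 k hk).eq_or_lt with h0 | h0
    · rw [hYzero k hk h0.symm, zero_mul]
    · refine mul_nonneg (hYpos k hk h0).le ?_
      rw [← hv_sum, ← hsumlog k hk h0]
      exact sum_le_sum (hle k hk h0)
  have hskew : ∑ k ∈ s, Y k * ∑ i ∈ s, a k i * Y i = 0 := sum_mul_sum_skew s ha Y
  have hall := (sum_eq_zero_iff_of_nonneg hterm).1 hskew
  rcases (hy 0 k hk).eq_or_lt with h0 | h0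
  · rw [hstep 0 k hk, ← h0, zero_mul]
  · have h1 : ∑ t ∈ range m, v t k = 0 := by
      rw [hv_sum]
      exact (mul_eq_zero.1 (hall k hk)).resolve_left (hYpos k hk h0).ne'
    have h2 := (sum_eq_sum_iff_of_le (hle k hk h0)).1 ((hsumlog k hk h0).trans h1.symm) 0
      (mem_range.2 hm)
    have h3 : v 0 k = 0 := by
      by_contra hne
      have := Real.log_lt_sub_one_of_pos (hlog k hk h0 0 hm).1 (by simpa using hne)
      linarith
    rw [hstep 0 k hk]
    change y 0 k * (1 + v 0 k) = _
    rw [h3, add_zero, mul_one]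

/-! ### Norm and pointwise convergence on the simplex -/

section Simplex

theorem norm_eq_tsum_abs (x : Ell1) : ‖x‖ = ∑' k, |x k| := by
  simp [lp.norm_eq_tsum_rpow (p := 1) (by simp) x]

theorem summable_abs (x : Ell1) : Summable fun k => |x k| := by
  simpa using (memℓp_gen_iff (p := 1) (by simp)).1 (lp.memℓp x)

theorem summable_coe (x : Ell1) : Summable fun k => x k := (summable_abs x).of_abs

theorem hasSum_simplex (x : simplex) : HasSum (fun k => x.1 k) 1 := by
  have h : ∑' k, x.1 k = 1 := by
    rw [← x.2.2, norm_eq_tsum_abs]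
    exact tsum_congr fun k => (abs_of_nonneg (x.2.1 k)).symm
  exact h ▸ (summable_coe x.1).hasSum

theorem apply_le_one (x : simplex) (k : ℕ) : x.1 k ≤ 1 :=
  le_hasSum (hasSum_simplex x) k fun j _ => x.2.1 j

theorem exists_simplex_of_hasSum {w : ℕ → ℝ} (h0 : ∀ k, 0 ≤ w k) (h1 : HasSum w 1) :
    ∃ x : simplex, ∀ k, x.1 k = w k := by
  have hmem : Memℓp (E := fun _ : ℕ => ℝ) w 1 :=
    memℓp_gen (by simpa using h1.summable.abs)
  refine ⟨⟨⟨w, hmem⟩, h0, ?_⟩, fun k => rfl⟩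
  rw [norm_eq_tsum_abs, ← h1.tsum_eq]
  exact tsum_congr fun k => abs_of_nonneg (h0 k)

theorem isClosed_simplex : IsClosed simplex := by
  have h : simplex = (⋂ k, {x : Ell1 | 0 ≤ x k}) ∩ {x | ‖x‖ = 1} := by
    ext x
    simp [simplex]
  rw [h]
  refine (isClosed_iInter fun k => isClosed_le continuous_const ?_).inter
    (isClosed_eq continuous_norm continuous_const)
  exact (lp.lipschitzWith_one_eval 1 k).continuous

/-- On the simplex, pointwise convergence implies convergence in norm. -/
theorem tendsto_of_tendsto_apply {α : Type*} {l : Filter α} {x : α → simplex} {w : simplex}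
    (h : ∀ k, Tendsto (fun n => (x n).1 k) l (𝓝 (w.1 k))) :
    Tendsto (fun n => (x n).1) l (𝓝 w.1) := by
  -- Scheffé's argument: the minima are dominated by `w`, and `|s - t| = s + t - 2 min s t`.
  have hmin : Tendsto (fun n => ∑' k, min ((x n).1 k) (w.1 k)) l (𝓝 (∑' k, w.1 k)) := by
    refine tendsto_tsum_of_dominated_convergence (bound := fun k => w.1 k) (summable_coe w.1)
      (fun k => ?_) (Eventually.of_forall fun n k => ?_)
    · simpa using (h k).min (tendsto_const_nhds (x := w.1 k))
    · rw [Real.norm_of_nonneg (le_min ((x n).2.1 k) (w.2.1 k))]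
      exact min_le_right _ _
  rw [(hasSum_simplex w).tsum_eq] at hmin
  rw [tendsto_iff_norm_sub_tendsto_zero]
  have hnorm : ∀ n, ‖(x n).1 - w.1‖ = 2 - 2 * ∑' k, min ((x n).1 k) (w.1 k) := by
    intro n
    have hsum : Summable fun k => min ((x n).1 k) (w.1 k) :=
      Summable.of_nonneg_of_le (fun k => le_min ((x n).2.1 k) (w.2.1 k))
        (fun k => min_le_right _ _) (summable_coe w.1)
    have hs := ((hasSum_simplex (x n)).add (hasSum_simplex w)).sub (hsum.hasSum.mul_left 2)
    rw [norm_eq_tsum_abs]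
    have : ∀ k, |((x n).1 - w.1 : Ell1) k|
        = (x n).1 k + w.1 k - 2 * min ((x n).1 k) (w.1 k) := by
      intro k
      rw [lp.coeFn_sub, Pi.sub_apply]
      rcases le_total ((x n).1 k) (w.1 k) with hk | hk
      · rw [min_eq_left hk, abs_of_nonpos (by linarith)]; ring
      · rw [min_eq_right hk, abs_of_nonneg (by linarith)]; ring
    simp only [this]
    rw [hs.tsum_eq]
    norm_num
  simp only [hnorm]
  have := (hmin.const_mul 2).const_sub 2
  simpa using this

end Simplex

/-! ### The two blocks along an orbit -/

section Blocks

variable {V : simplex → simplex} {a : ℕ → ℕ → ℝ} {k₀ : ℕ}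

theorem summable_row (ha : a ∈ skewMatrices) (x : simplex) (k : ℕ) :
    Summable fun i => a k i * x.1 i := by
  refine Summable.of_norm_bounded (summable_coe x.1) fun i => ?_
  rw [Real.norm_eq_abs, abs_mul, abs_of_nonneg (x.2.1 i)]
  exact mul_le_of_le_one_left (x.2.1 i) (ha k i).2

theorem apply_head (hV : HasMatrix V a) (h0 : ∀ k i, k < k₀ → k₀ ≤ i → a k i = 0)
    (x : simplex) {k : ℕ} (hk : k < k₀) :
    (V x).1 k = x.1 k * (1 + ∑ i ∈ range k₀, a k i * x.1 i) := by
  rw [hV.2, tsum_eq_sum (s := range k₀)]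
  intro i hi
  rw [h0 k i hk (by simpa using hi), zero_mul]

theorem sum_head (hV : HasMatrix V a) (h0 : ∀ k i, k < k₀ → k₀ ≤ i → a k i = 0)
    (x : simplex) : ∑ k ∈ range k₀, (V x).1 k = ∑ k ∈ range k₀, x.1 k := by
  have h : ∀ k ∈ range k₀, (V x).1 k = x.1 k * (1 + ∑ i ∈ range k₀, a k i * x.1 i) :=
    fun k hk => apply_head hV h0 x (mem_range.1 hk)
  rw [sum_congr rfl h]
  simp only [mul_add, mul_one, sum_add_distrib]
  rw [sum_mul_sum_skew _ (fun k i => (hV.1 k i).1), add_zero]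

theorem sum_head_iterate (hV : HasMatrix V a) (h0 : ∀ k i, k < k₀ → k₀ ≤ i → a k i = 0)
    (x : simplex) (n : ℕ) :
    ∑ k ∈ range k₀, (V^[n] x).1 k = ∑ k ∈ range k₀, x.1 k := by
  induction n with
  | zero => rfl
  | succ n ih => rw [Function.iterate_succ_apply', sum_head hV h0, ih]

/-- The mass carried by the coordinates of a segment of the second block changes only by the
exchange with the coordinates beyond it. -/
theorem sum_Ico (hV : HasMatrix V a) (h0 : ∀ k i, k < k₀ → k₀ ≤ i → a k i = 0)
    (x : simplex) (m : ℕ) :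
    ∑ k ∈ Ico k₀ m, (V x).1 k =
      ∑ k ∈ Ico k₀ m, x.1 k + ∑ k ∈ Ico k₀ m, x.1 k * ∑' i, a k (i + m) * x.1 (i + m) := by
  have hrow : ∀ k ∈ Ico k₀ m, (V x).1 k = x.1 k + x.1 k * ∑ i ∈ Ico k₀ m, a k i * x.1 i
      + x.1 k * ∑' i, a k (i + m) * x.1 (i + m) := by
    intro k hk
    rw [mem_Ico] at hk
    -- By skew-symmetry the lower left block vanishes too.
    have hsplit : ∑ i ∈ Ico k₀ m, a k i * x.1 i = ∑ i ∈ range m, a k i * x.1 i := by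
      refine sum_subset (fun i hi => by simp at hi ⊢; omega) fun i hi hi' => ?_
      simp only [mem_range, mem_Ico, not_and, not_lt] at hi hi'
      rw [(hV.1 k i).1, h0 i k (by omega) hk.1, neg_zero, zero_mul]
    rw [hV.2, ← (summable_row hV.1 x k).sum_add_tsum_nat_add m, hsplit]
    ring
  rw [sum_congr rfl hrow, sum_add_distrib, sum_add_distrib,
    sum_mul_sum_skew _ (fun k i => (hV.1 k i).1), add_zero]

/-- By `sum_Ico` the exchange term has constant sign, so these masses are monotone in `n`; they lie
in `[0, 1]`. -/
theorem exists_tendsto_sum_Ico (hV : HasMatrix V a)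
    (h0 : ∀ k i, k < k₀ → k₀ ≤ i → a k i = 0)
    (hsign : (∀ k i, k₀ ≤ k → k < i → 0 ≤ a k i) ∨ (∀ k i, k₀ ≤ k → k < i → a k i ≤ 0))
    (x : simplex) (m : ℕ) :
    ∃ z, Tendsto (fun n => ∑ k ∈ Ico k₀ m, (V^[n] x).1 k) atTop (𝓝 z) := by
  rcases hsign with hs | hs
  · refine ⟨_, tendsto_atTop_ciSup (monotone_nat_of_le_succ fun n => ?_)
      ⟨1, Set.forall_mem_range.2 fun n => ?_⟩⟩
    · rw [Function.iterate_succ_apply', sum_Ico hV h0]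
      refine le_add_of_nonneg_right (sum_nonneg fun k hk => mul_nonneg ((V^[n] x).2.1 k)
        (tsum_nonneg fun i => mul_nonneg (hs _ _ ?_ ?_) ((V^[n] x).2.1 _)))
      all_goals rw [mem_Ico] at hk; omega
    · exact sum_le_hasSum _ (fun j _ => (V^[n] x).2.1 j) (hasSum_simplex _)
  · refine ⟨_, tendsto_atTop_ciInf (antitone_nat_of_succ_le fun n => ?_)
      ⟨0, Set.forall_mem_range.2 fun n => ?_⟩⟩
    · rw [Function.iterate_succ_apply', sum_Ico hV h0]
      refine add_le_of_nonpos_right (sum_nonpos fun k hk =>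
        mul_nonpos_of_nonneg_of_nonpos ((V^[n] x).2.1 k)
        (tsum_nonpos fun i => mul_nonpos_of_nonpos_of_nonneg (hs _ _ ?_ ?_) ((V^[n] x).2.1 _)))
      all_goals rw [mem_Ico] at hk; omega
    · exact sum_nonneg fun j _ => (V^[n] x).2.1 j

theorem exists_tendsto_tail (hV : HasMatrix V a) (h0 : ∀ k i, k < k₀ → k₀ ≤ i → a k i = 0)
    (hsign : (∀ k i, k₀ ≤ k → k < i → 0 ≤ a k i) ∨ (∀ k i, k₀ ≤ k → k < i → a k i ≤ 0))
    (x : simplex) : ∃ z : ℕ → ℝ, ∀ k ≥ k₀, Tendsto (fun n => (V^[n] x).1 k) atTop (𝓝 (z k)) := by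
  have h : ∀ k ≥ k₀, ∃ z, Tendsto (fun n => (V^[n] x).1 k) atTop (𝓝 z) := by
    intro k hk
    obtain ⟨z, hz⟩ := exists_tendsto_sum_Ico hV h0 hsign x k
    obtain ⟨z', hz'⟩ := exists_tendsto_sum_Ico hV h0 hsign x (k + 1)
    refine ⟨z' - z, (hz'.sub hz).congr fun n => ?_⟩
    rw [sum_Ico_succ_top hk, add_sub_cancel_left]
  choose! z hz using h
  exact ⟨z, hz⟩

/-- The Volterra operator of the first block, extended by the identity. -/
def headMap (a : ℕ → ℕ → ℝ) (k₀ : ℕ) (y : ℕ → ℝ) (k : ℕ) : ℝ :=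
  if k < k₀ then y k * (1 + ∑ i ∈ range k₀, a k i * y i) else y k

theorem continuous_headMap : Continuous (headMap a k₀) := by
  refine continuous_pi fun k => ?_
  unfold headMap
  split_ifs <;> fun_prop

theorem headMap_eq_of_iterate_eq (ha : a ∈ skewMatrices) {y : ℕ → ℝ}
    (hy : ∀ t, ∀ k < k₀, 0 ≤ (headMap a k₀)^[t] y k) {m : ℕ} (hm : 0 < m)
    (hper : (headMap a k₀)^[m] y = y) : headMap a k₀ y = y := by
  funext k
  by_cases hk : k < k₀
  · refine stationary_of_periodic (range k₀) (fun k i => (ha k i).1)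
      (y := fun t => (headMap a k₀)^[t] y) (fun t k hk => hy t k (mem_range.1 hk))
      (fun t k hk => ?_) hm (fun k _ => congrFun hper k) (mem_range.2 hk)
    simp only [Function.iterate_succ_apply']
    exact if_pos (mem_range.1 hk)
  · exact if_neg hk

/-- The orbit of `x` as a sequence in the space of all real sequences. -/
def coordOrbit (V : simplex → simplex) (x : simplex) (n j : ℕ) : ℝ := (V^[n] x).1 j

theorem coordOrbit_mem (x : simplex) (n : ℕ) :
    coordOrbit V x n ∈ Set.univ.pi fun _ : ℕ => Set.Icc (0 : ℝ) 1 :=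
  fun k _ => ⟨(V^[n] x).2.1 k, apply_le_one _ k⟩

theorem isCompact_cube : IsCompact (Set.univ.pi fun _ : ℕ => Set.Icc (0 : ℝ) 1) :=
  isCompact_univ_pi fun _ => isCompact_Icc

theorem mem_cube_of_mapClusterPt {x : simplex} {y : ℕ → ℝ}
    (hy : MapClusterPt y atTop (coordOrbit V x)) :
    y ∈ Set.univ.pi fun _ : ℕ => Set.Icc (0 : ℝ) 1 :=
  isCompact_cube.isClosed.mem_of_mapClusterPt hy (Eventually.of_forall (coordOrbit_mem x))

theorem apply_eq_of_mapClusterPt {x : simplex} {y : ℕ → ℝ}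
    (hy : MapClusterPt y atTop (coordOrbit V x)) {k : ℕ} {z : ℝ}
    (hz : Tendsto (fun n => (V^[n] x).1 k) atTop (𝓝 z)) : y k = z := by
  have := neBot_inf_comap_of_mapClusterPt hy
  have h : Tendsto (coordOrbit V x) (atTop ⊓ comap (coordOrbit V x) (𝓝 y)) (𝓝 y) :=
    tendsto_comap.mono_left inf_le_right
  exact tendsto_nhds_unique (tendsto_pi_nhds.1 h k) (hz.mono_left inf_le_left)

/-- In the first block the orbit obeys `headMap` exactly; beyond it, coordinates converge, so the
identity is the right map at cluster points. This avoids any continuity of `V` itself. -/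
theorem tendsto_coordOrbit_succ (hV : HasMatrix V a) (h0 : ∀ k i, k < k₀ → k₀ ≤ i → a k i = 0)
    {x : simplex} {z : ℕ → ℝ} (hz : ∀ k ≥ k₀, Tendsto (fun n => (V^[n] x).1 k) atTop (𝓝 (z k)))
    {y : ℕ → ℝ} (hy : MapClusterPt y atTop (coordOrbit V x)) :
    Tendsto (fun n => coordOrbit V x (n + 1)) (atTop ⊓ comap (coordOrbit V x) (𝓝 y))
      (𝓝 (headMap a k₀ y)) := by
  refine tendsto_pi_nhds.2 fun k => ?_
  by_cases hk : k < k₀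
  · have h : Tendsto (fun n => headMap a k₀ (coordOrbit V x n))
        (atTop ⊓ comap (coordOrbit V x) (𝓝 y)) (𝓝 (headMap a k₀ y)) :=
      (continuous_headMap.tendsto y).comp (tendsto_comap.mono_left inf_le_right)
    refine (tendsto_pi_nhds.1 h k).congr fun n => ?_
    rw [headMap, if_pos hk]
    change _ = (V^[n + 1] x).1 k
    rw [Function.iterate_succ_apply', apply_head hV h0 _ hk]
    rfl
  · rw [headMap, if_neg hk, apply_eq_of_mapClusterPt hy (hz k (not_lt.1 hk))]
    exact ((hz k (not_lt.1 hk)).comp (tendsto_add_atTop_nat 1)).mono_left inf_le_left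

theorem subsingleton_of_finite_coordOrbit (hV : HasMatrix V a)
    (h0 : ∀ k i, k < k₀ → k₀ ≤ i → a k i = 0) {x : simplex} {z : ℕ → ℝ}
    (hz : ∀ k ≥ k₀, Tendsto (fun n => (V^[n] x).1 k) atTop (𝓝 (z k)))
    (hfin : {y | MapClusterPt y atTop (coordOrbit V x)}.Finite) :
    {y | MapClusterPt y atTop (coordOrbit V x)}.Subsingleton := by
  refine subsingleton_of_finite_mapClusterPt isCompact_cube (coordOrbit_mem x) hfin
    (fun y hy => tendsto_coordOrbit_succ hV h0 hz hy) fun y hy m hm hper => ?_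
  -- Iterates of a cluster point stay in the cube, which supplies the nonnegativity needed for
  -- periodic orbits.
  have hmaps : ∀ t, MapClusterPt ((headMap a k₀)^[t] y) atTop (coordOrbit V x) := by
    intro t
    induction t with
    | zero => exact hy
    | succ t ih =>
      rw [Function.iterate_succ_apply']
      exact mapClusterPt_of_tendsto_succ ih (tendsto_coordOrbit_succ hV h0 hz ih)
  exact headMap_eq_of_iterate_eq hV.1
    (fun t k _ => (mem_cube_of_mapClusterPt (hmaps t) k trivial).1) hm hper

theorem mapClusterPt_coordOrbit {x : simplex} {y : Ell1}
    (hy : MapClusterPt y atTop fun n => (V^[n] x).1) :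
    MapClusterPt (fun k => y k) atTop (coordOrbit V x) := by
  have hc : Continuous fun (w : Ell1) (k : ℕ) => w k :=
    continuous_pi fun k => (lp.lipschitzWith_one_eval 1 k).continuous
  exact hy.continuousAt_comp hc.continuousAt

theorem sum_head_of_mapClusterPt (hV : HasMatrix V a)
    (h0 : ∀ k i, k < k₀ → k₀ ≤ i → a k i = 0) {x : simplex} {y : ℕ → ℝ}
    (hy : MapClusterPt y atTop (coordOrbit V x)) :
    ∑ k ∈ range k₀, y k = ∑ k ∈ range k₀, x.1 k := by
  have hclosed : IsClosed {w : ℕ → ℝ | ∑ k ∈ range k₀, w k = ∑ k ∈ range k₀, x.1 k} :=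
    isClosed_eq (by fun_prop) continuous_const
  exact hclosed.mem_of_mapClusterPt hy
    (Eventually.of_forall fun n => sum_head_iterate hV h0 x n)

/-- If the orbit has a cluster point in norm, then no mass escapes to infinity, and every pointwise
cluster point is one in norm. -/
theorem exists_mapClusterPt_norm (hV : HasMatrix V a)
    (h0 : ∀ k i, k < k₀ → k₀ ≤ i → a k i = 0) {x : simplex} {z : ℕ → ℝ}
    (hz : ∀ k ≥ k₀, Tendsto (fun n => (V^[n] x).1 k) atTop (𝓝 (z k)))
    {y : Ell1} (hy : MapClusterPt y atTop fun n => (V^[n] x).1) {w : ℕ → ℝ}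
    (hw : MapClusterPt w atTop (coordOrbit V x)) :
    ∃ w' : Ell1, (fun k => w' k) = w ∧ MapClusterPt w' atTop fun n => (V^[n] x).1 := by
  have hyS : y ∈ simplex :=
    isClosed_simplex.mem_of_mapClusterPt hy (Eventually.of_forall fun n => (V^[n] x).2)
  have hy' := mapClusterPt_coordOrbit hy
  -- `w` and `y` have the same conserved mass below `k₀` and the same coordinates from `k₀` on.
  have hsum : HasSum w 1 := by
    rw [← hasSum_nat_add_iff' k₀, sum_head_of_mapClusterPt hV h0 hw,
      ← sum_head_of_mapClusterPt hV h0 hy']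
    refine ((hasSum_nat_add_iff' k₀).2 (hasSum_simplex ⟨y, hyS⟩)).congr_fun fun k => ?_
    have hk := hz (k + k₀) (by omega)
    rw [apply_eq_of_mapClusterPt hw hk]
    exact (apply_eq_of_mapClusterPt hy' hk).symm
  obtain ⟨w', hw'⟩ := exists_simplex_of_hasSum
    (fun k => (mem_cube_of_mapClusterPt hw k trivial).1) hsum
  refine ⟨w'.1, funext hw', ?_⟩
  have := neBot_inf_comap_of_mapClusterPt hw
  have ht : Tendsto (coordOrbit V x) (atTop ⊓ comap (coordOrbit V x) (𝓝 w)) (𝓝 w) :=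
    tendsto_comap.mono_left inf_le_right
  refine (tendsto_of_tendsto_apply (x := fun n => V^[n] x) (w := w') fun k => ?_).mapClusterPt.mono
    (inf_le_left : atTop ⊓ comap (coordOrbit V x) (𝓝 w) ≤ atTop)
  rw [hw']
  exact tendsto_pi_nhds.1 ht k

end Blocks

end Volterra

theorem theorem1p2 (V : Volterra.simplex → Volterra.simplex)
    (hV : V ∈ Volterra.classPlus ∪ Volterra.classMinus) (x₀ : Volterra.simplex) :
    ((Volterra.omegaNorm V x₀).Nonempty →
      (Volterra.omegaNorm V x₀).encard = 1 ∨ (Volterra.omegaNorm V x₀).encard = ⊤) ∧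
    ((Volterra.omegaPointwise V x₀).encard = 1 ∨
      (Volterra.omegaPointwise V x₀).encard = ⊤) := by
  obtain ⟨a, k₀, hVa, h0, hsign⟩ : ∃ a k₀, Volterra.HasMatrix V a ∧
      (∀ k i, k < k₀ → k₀ ≤ i → a k i = 0) ∧
      ((∀ k i, k₀ ≤ k → k < i → 0 ≤ a k i) ∨ (∀ k i, k₀ ≤ k → k < i → a k i ≤ 0)) := by
    rcases hV with ⟨a, hVa, k₀, h0, hs⟩ | ⟨a, hVa, k₀, h0, hs⟩
    · exact ⟨a, k₀, hVa, h0, Or.inl hs⟩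
    · exact ⟨a, k₀, hVa, h0, Or.inr hs⟩
  obtain ⟨z, hz⟩ := Volterra.exists_tendsto_tail hVa h0 hsign x₀
  have hnorm : Volterra.omegaNorm V x₀ = {y | MapClusterPt y atTop fun n => (V^[n] x₀).1} :=
    Volterra.iInter_closure_tail _
  have hpw : Volterra.omegaPointwise V x₀ =
      {y | MapClusterPt y atTop (Volterra.coordOrbit V x₀)} :=
    Volterra.iInter_closure_tail (Volterra.coordOrbit V x₀)
  have hsub := Volterra.subsingleton_of_finite_coordOrbit hVa h0 hz
  rw [hnorm, hpw]
  refine ⟨fun ⟨y, hy⟩ => ?_, ?_⟩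
  · rw [or_iff_not_imp_right, ← ne_eq, Set.encard_ne_top_iff, Set.encard_eq_one]
    intro hfin
    -- Every pointwise cluster point comes from a norm one, so finiteness transfers to the pointwise
    -- set.
    have hsub' := hsub <| (hfin.image fun (w : Volterra.Ell1) (k : ℕ) => w k).subset fun w hw => by
      obtain ⟨w', rfl, hw'⟩ := Volterra.exists_mapClusterPt_norm hVa h0 hz hy hw
      exact ⟨w', hw', rfl⟩
    refine ⟨y, Set.Subsingleton.eq_singleton_of_mem (fun u hu v hv => ?_) hy⟩
    exact lp.ext (hsub' (Volterra.mapClusterPt_coordOrbit hu) (Volterra.mapClusterPt_coordOrbit hv))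
  · rw [or_iff_not_imp_right, ← ne_eq, Set.encard_ne_top_iff, Set.encard_eq_one]
    intro hfin
    obtain ⟨y, -, hy⟩ := Volterra.isCompact_cube.exists_mapClusterPt_of_frequently (l := atTop)
      (Frequently.of_forall (Volterra.coordOrbit_mem (V := V) x₀))
    exact ⟨y, (hsub hfin).eq_singleton_of_mem hy⟩
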